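/- Let $(\Omega,\mathcal F,\mu)$ be a finite measure space and let $E$ be a real Banach space with dual $E^*$. Let $\mathcal L^1_E$ be the space of Bochner $\mu$-integrable functions $f:\Omega\to E$ with the seminorm $\|f\|_1=\int_\Omega\|f\|\,d\mu$; convergence in this seminorm is called strong convergence. Let $\mathcal L^\infty_{E^*}[E]$ be the space of bounded scalarly measurable functions $b:\Omega\to E^*$ (that is, $\omega\mapsto\langle x,b(\omega)\rangle$ is $\mu$-measurable for each $x\in E$), and let $\mathcal L^\infty_{E^*}$ be its subspace of strongly $\mu$-measurable functions. Both spaces are paired with $\mathcal L^1_E$ by $(f,b)\mapsto\int_\Omega\langle f(\omega),b(\omega)\rangle\,d\mu(\omega)$. Weak convergence in $\mathcal L^1_E$ is convergence in the topology $\sigma(\mathcal L^1_E,\mathcal L^\infty_{E^*}[E])$. For $B\in\mathcal F$ let $\mathcal F^+(B)$ be the collection of all measurable $A\subseteq B$ with $\mu(A)>0$, and let $\mathcal F^+=\mathcal F^+(\Omega)$. For $f\in\mathcal L^1_E$ and $A\in\mathcal F$ put $$m_A(f)=\frac{1}{\mu(A)}\int_A f\,d\mu,\qquad \operatorname{Bocce-osc}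 f|_A=\frac{1}{\mu(A)}\int_A\|f-m_A(f)\|\,d\mu,$$ with the convention that both are $0$ if $\mu(A)=0$. A sequence $(f_k)$ in $\mathcal L^1_E$ satisfies the sequential Bocce criterion if for each subsequence $(f_{k_j})$ of $(f_k)$, each $\varepsilon>0$ and each $B\in\mathcal F^+$ there is a set $A\in\mathcal F^+(B)$ such that $\liminf_j\operatorname{Bocce-osc} f_{k_j}|_A<\varepsilon$. **Theorem.** Let $(f_k)$ be a sequence in $\mathcal L^1_E$ and let $f_0\in\mathcal L^1_E$. Then $(f_k)$ converges strongly to $f_0$ if and only if the following three conditions hold: 1. $(f_k)$ converges weakly to $f_0$; 2. $(f_k)$ satisfies the sequential Bocce criterion; 3. for each $B\in\mathcal F^+$ the set $\{m_B(f_k):k\in\mathbb N\}$ is relatively norm compact in $E$. Condition (1) may be replaced with - (1') $(f_k)$ converges to $f_0$ in the topology $\sigma(\mathcal L^1_E,\mathcal L^\infty_{E^*})$. Also, whether (1) or (1') is used, condition (3) may be replaced with - (3') $\lim_k\|m_B(f_k)-m_B(f_0)\|=0$ for each $B\in\mathcal F^+$. The statements with condition (1) hold equally when weak convergence is understood as convergence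 against every continuous linear functional on $(\mathcal L^1_E,\|\cdot\|_1)$. -/

import Mathlib

open MeasureTheory Filter Topology

noncomputable section

namespace BocceL1

variable {Ω E : Type*} [MeasurableSpace Ω] [NormedAddCommGroup E] [NormedSpace ℝ E]

/-- The subsets of `B` of strictly positive measure: the measurable `A ⊆ B` with `μ A > 0`. -/
def PosSubsets (μ : Measure Ω) (B : Set Ω) : Set (Set Ω) :=
  {A | MeasurableSet A ∧ A ⊆ B ∧ 0 < μ A}

/-- The average value `m_A(f) = (∫_A f dμ) / μ(A)`, equal to `0` when `μ A = 0`. -/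
def avg (μ : Measure Ω) (A : Set Ω) (f : Ω → E) : E :=
  (μ.real A)⁻¹ • ∫ ω in A, f ω ∂μ

/-- The Bocce oscillation `(∫_A ‖f - m_A(f)‖ dμ) / μ(A)`, equal to `0` when `μ A = 0`. -/
def bocceOsc (μ : Measure Ω) (A : Set Ω) (f : Ω → E) : ℝ :=
  (∫ ω in A, ‖f ω - avg μ A f‖ ∂μ) / μ.real A

/-- The sequential Bocce criterion. The lower limit is taken in the extended reals, so that it
is the usual one also when the oscillations are unbounded. -/
def SequentialBocce (μ : Measure Ω) (f : ℕ → Ω → E) : Prop :=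
  ∀ n : ℕ → ℕ, StrictMono n → ∀ ε : ℝ, 0 < ε → ∀ B ∈ PosSubsets μ Set.univ,
    ∃ A ∈ PosSubsets μ B,
      liminf (fun j => ((bocceOsc μ A (f (n j)) : ℝ) : EReal)) atTop < (ε : EReal)

/-- Strong convergence: convergence in the seminorm `‖f‖₁ = ∫ ‖f‖ dμ`. -/
def ConvergesStrongly (μ : Measure Ω) (f : ℕ → Ω → E) (f₀ : Ω → E) : Prop :=
  Tendsto (fun k => ∫ ω, ‖f k ω - f₀ ω‖ ∂μ) atTop (𝓝 0)

/-- The bounded scalarly measurable functions `b : Ω → E*`: for each `x` in `E`, the scalar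
function `ω ↦ ⟨x, b ω⟩` is `μ`-measurable. -/
def ScalarLinfty (μ : Measure Ω) (E : Type*) [NormedAddCommGroup E] [NormedSpace ℝ E] :
    Set (Ω → StrongDual ℝ E) :=
  {b | (∀ x : E, AEMeasurable (fun ω => b ω x) μ) ∧ ∃ C : ℝ, ∀ ω, ‖b ω‖ ≤ C}

/-- The bounded strongly `μ`-measurable functions `b : Ω → E*`. -/
def StrongLinfty (μ : Measure Ω) (E : Type*) [NormedAddCommGroup E] [NormedSpace ℝ E] :
    Set (Ω → StrongDual ℝ E) :=
  {b | AEStronglyMeasurable b μ ∧ ∃ C : ℝ, ∀ ω, ‖b ω‖ ≤ C}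

/-- Convergence in the topology `σ(L¹_E, S)` given by the pairing `⟨f, b⟩ = ∫ ⟨f ω, b ω⟩ dμ(ω)`
with the functions `b` of the class `S`. -/
def ConvergesAgainst (μ : Measure Ω) (S : Set (Ω → StrongDual ℝ E))
    (f : ℕ → Ω → E) (f₀ : Ω → E) : Prop :=
  ∀ b ∈ S, Tendsto (fun k => ∫ ω, b ω (f k ω) ∂μ) atTop (𝓝 (∫ ω, b ω (f₀ ω) ∂μ))

/-- Weak convergence with respect to all continuous linear functionals on the normed space
`L¹_E` (of classes of functions). -/
def ConvergesDualWeakly (μ : Measure Ω) {f : ℕ → Ω → E} {f₀ : Ω → E}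
    (hf : ∀ k, Integrable (f k) μ) (hf₀ : Integrable f₀ μ) : Prop :=
  ∀ φ : StrongDual ℝ (Lp E 1 μ),
    Tendsto (fun k => φ ((hf k).toL1 (f k))) atTop (𝓝 (φ (hf₀.toL1 f₀)))

/-- For each `B` of positive measure the averages `m_B(f_k)` form a relatively norm compact
subset of `E`. -/
def AveragesRelCompact (μ : Measure Ω) (f : ℕ → Ω → E) : Prop :=
  ∀ B ∈ PosSubsets μ Set.univ, IsCompact (closure (Set.range fun k => avg μ B (f k)))

/-- For each `B` of positive measure the averages `m_B(f_k)` converge in norm to `m_B(f₀)`. -/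
def AveragesConverge (μ : Measure Ω) (f : ℕ → Ω → E) (f₀ : Ω → E) : Prop :=
  ∀ B ∈ PosSubsets μ Set.univ,
    Tendsto (fun k => ‖avg μ B (f k) - avg μ B f₀‖) atTop (𝓝 0)

end BocceL1

end

namespace BocceL1

variable {Ω E : Type*} [MeasurableSpace Ω] [NormedAddCommGroup E] [NormedSpace ℝ E]

/-! ### The pairing of integrable functions with bounded scalarly measurable functions -/

/-! Strong convergence implies every other condition by norm estimates; for the Bocce criterion,
take a set on which `f₀` is nearly constant. Conversely, every version of weak convergence implies
convergence against `StrongLinfty`. Testing with `1_B x'` makes the averages converge weakly, and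
compactness makes that norm convergence. The rest combines two facts about `‖f_k - f₀‖`. A Baire
argument in the unit ball of `L^∞` with the `L¹` metric gives equi-integrability
(`exists_forall_setIntegral_norm_le`). The Bocce criterion and convergent averages give, inside
every set of positive measure, a smaller one where the mean of `‖f_k - f₀‖` is small for infinitely
many indices of a given subsequence. If the integrals did not tend to zero, Zorn's lemma would
provide a maximal disjoint family of such sets, any finitely many of them good for a common infinite
set of bad indices. Maximality makes the family cover `Ω` up to a null set; finitely many members
leave a remainder that equi-integrability controls, a contradiction
(`tendsto_integral_zero_of_frequently_setIntegral_le`). -/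

lemma aemeasurable_dual_apply {μ : Measure Ω} {b : Ω → StrongDual ℝ E}
    (hb : ∀ x : E, AEMeasurable (fun ω => b ω x) μ) {f : Ω → E} (hf : AEStronglyMeasurable f μ) :
    AEMeasurable (fun ω => b ω (f ω)) μ := by
  -- Measurability is known only at fixed vectors, so it is glued over the fibres of a simple
  -- function; continuity of each `b ω` then carries it to limits.
  have hsimple : ∀ s : SimpleFunc Ω E, AEMeasurable (fun ω => b ω (s ω)) μ := by
    intro s
    have hs : (fun ω => b ω (s ω)) =
        ∑ y ∈ s.range, (s ⁻¹' {y}).indicator (fun ω => b ω y) := by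
      ext ω
      rw [Finset.sum_apply, Finset.sum_eq_single (s ω)]
      · simp
      · intro y _ hy
        simp [Ne.symm hy]
      · intro h
        exact absurd (s.mem_range_self ω) h
    rw [hs]
    exact Finset.aemeasurable_sum _ fun y _ => (hb y).indicator (s.measurableSet_fiber y)
  refine aemeasurable_of_tendsto_metrizable_ae atTop
    (fun n => hsimple (hf.stronglyMeasurable_mk.approx n)) ?_
  filter_upwards [hf.ae_eq_mk] with ω hω
  rw [hω]
  exact ((b ω).continuous.tendsto _).comp (hf.stronglyMeasurable_mk.tendsto_approx ω)

lemma integrable_dual_apply {μ : Measure Ω} {b : Ω → StrongDual ℝ E}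
    (hb : b ∈ ScalarLinfty μ E) {f : Ω → E} (hf : Integrable f μ) :
    Integrable (fun ω => b ω (f ω)) μ := by
  obtain ⟨hbm, C, hC⟩ := hb
  refine (hf.norm.const_mul C).mono'
    (aemeasurable_dual_apply hbm hf.aestronglyMeasurable).aestronglyMeasurable ?_
  exact Eventually.of_forall fun ω => (b ω).le_of_opNorm_le (hC ω) _

lemma strongLinfty_subset_scalarLinfty (μ : Measure Ω) : StrongLinfty μ E ⊆ ScalarLinfty μ E :=
  fun _ hb => ⟨fun x => (hb.1.apply_continuousLinearMap x).aemeasurable, hb.2⟩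

lemma norm_integral_dual_apply_le {μ : Measure Ω} {b : Ω → StrongDual ℝ E} {C : ℝ}
    (hC : ∀ ω, ‖b ω‖ ≤ C) {f : Ω → E} (hf : Integrable f μ) :
    ‖∫ ω, b ω (f ω) ∂μ‖ ≤ C * ∫ ω, ‖f ω‖ ∂μ := by
  rw [← integral_const_mul]
  exact norm_integral_le_of_norm_le (hf.norm.const_mul C)
    (Eventually.of_forall fun ω => (b ω).le_of_opNorm_le (hC ω) _)

lemma integral_dual_apply_sub {μ : Measure Ω} {b : Ω → StrongDual ℝ E}
    (hb : b ∈ ScalarLinfty μ E) {f g : Ω → E} (hf : Integrable f μ) (hg : Integrable g μ) :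
    ∫ ω, b ω (f ω - g ω) ∂μ = ∫ ω, b ω (f ω) ∂μ - ∫ ω, b ω (g ω) ∂μ := by
  rw [← integral_sub (integrable_dual_apply hb hf) (integrable_dual_apply hb hg)]
  simp

lemma ConvergesAgainst.mono {μ : Measure Ω} {S T : Set (Ω → StrongDual ℝ E)} (hST : S ⊆ T)
    {f : ℕ → Ω → E} {f₀ : Ω → E} (h : ConvergesAgainst μ T f f₀) : ConvergesAgainst μ S f f₀ :=
  fun b hb => h b (hST hb)

lemma ConvergesStrongly.convergesAgainst {μ : Measure Ω} {f : ℕ → Ω → E} {f₀ : Ω → E}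
    (hf : ∀ k, Integrable (f k) μ) (hf₀ : Integrable f₀ μ) (h : ConvergesStrongly μ f f₀) :
    ConvergesAgainst μ (ScalarLinfty μ E) f f₀ := by
  intro b hb
  obtain ⟨C, hC⟩ := hb.2
  rw [tendsto_iff_norm_sub_tendsto_zero]
  refine squeeze_zero (fun _ => norm_nonneg _) (fun k => ?_)
    (by simpa using Tendsto.const_mul C h)
  rw [← integral_dual_apply_sub hb (hf k) hf₀]
  exact norm_integral_dual_apply_le hC ((hf k).sub hf₀)

/-! ### The norm dual of `L¹_E` -/

lemma ConvergesStrongly.convergesDualWeakly {μ : Measure Ω} {f : ℕ → Ω → E} {f₀ : Ω → E}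
    (hf : ∀ k, Integrable (f k) μ) (hf₀ : Integrable f₀ μ) (h : ConvergesStrongly μ f f₀) :
    ConvergesDualWeakly μ hf hf₀ := by
  intro φ
  refine (φ.continuous.tendsto _).comp ?_
  rw [tendsto_iff_norm_sub_tendsto_zero]
  refine h.congr fun k => ?_
  rw [← Integrable.toL1_sub, L1.norm_of_fun_eq_integral_norm]
  rfl

/-- Only this inclusion into the dual is needed; the dual of `L¹_E` never has to be identified. -/
lemma exists_dual_L1_eq_integral {μ : Measure Ω} {b : Ω → StrongDual ℝ E}
    (hb : b ∈ ScalarLinfty μ E) :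
    ∃ φ : StrongDual ℝ (Lp E 1 μ), ∀ f : Ω → E, ∀ hf : Integrable f μ,
      φ (hf.toL1 f) = ∫ ω, b ω (f ω) ∂μ := by
  obtain ⟨C, hC⟩ := hb.2
  let L : Lp E 1 μ →ₗ[ℝ] ℝ :=
    { toFun := fun F => ∫ ω, b ω (F ω) ∂μ
      map_add' := fun F G => by
        rw [← integral_add (integrable_dual_apply hb (L1.integrable_coeFn F))
          (integrable_dual_apply hb (L1.integrable_coeFn G))]
        refine integral_congr_ae ?_
        filter_upwards [Lp.coeFn_add F G] with ω hω
        rw [hω, Pi.add_apply, map_add]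
      map_smul' := fun c F => by
        rw [RingHom.id_apply, smul_eq_mul, ← integral_const_mul]
        refine integral_congr_ae ?_
        filter_upwards [Lp.coeFn_smul c F] with ω hω
        rw [hω, Pi.smul_apply, map_smul, smul_eq_mul] }
  refine ⟨L.mkContinuous C fun F => ?_, fun f hf => ?_⟩
  · rw [L1.norm_eq_integral_norm]
    exact norm_integral_dual_apply_le hC (L1.integrable_coeFn F)
  · refine integral_congr_ae ?_
    filter_upwards [hf.coeFn_toL1] with ω hω
    rw [hω]

lemma ConvergesDualWeakly.convergesAgainst {μ : Measure Ω} {f : ℕ → Ω → E} {f₀ : Ω → E}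
    {hf : ∀ k, Integrable (f k) μ} {hf₀ : Integrable f₀ μ} (h : ConvergesDualWeakly μ hf hf₀) :
    ConvergesAgainst μ (ScalarLinfty μ E) f f₀ := by
  intro b hb
  obtain ⟨φ, hφ⟩ := exists_dual_L1_eq_integral hb
  simpa only [hφ] using h φ

/-! ### Averages -/

lemma PosSubsets.measureReal_pos {μ : Measure Ω} [IsFiniteMeasure μ] {A B : Set Ω}
    (hA : A ∈ PosSubsets μ B) : 0 < μ.real A :=
  ENNReal.toReal_pos hA.2.2.ne' (measure_ne_top μ A)

lemma norm_avg_le (μ : Measure Ω) (A : Set Ω) (f : Ω → E) :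
    ‖avg μ A f‖ ≤ (μ.real A)⁻¹ * ∫ ω in A, ‖f ω‖ ∂μ := by
  rw [avg, norm_smul, norm_inv, Real.norm_of_nonneg measureReal_nonneg]
  gcongr
  exact norm_integral_le_integral_norm f

lemma avg_sub {μ : Measure Ω} (A : Set Ω) {f g : Ω → E} (hf : Integrable f μ)
    (hg : Integrable g μ) : avg μ A f - avg μ A g = avg μ A (fun ω => f ω - g ω) := by
  rw [avg, avg, avg, ← smul_sub, integral_sub hf.integrableOn hg.integrableOn]

lemma ConvergesStrongly.averagesConverge {μ : Measure Ω} {f : ℕ → Ω → E} {f₀ : Ω → E}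
    (hf : ∀ k, Integrable (f k) μ) (hf₀ : Integrable f₀ μ) (h : ConvergesStrongly μ f f₀) :
    AveragesConverge μ f f₀ := by
  intro B _
  refine squeeze_zero (fun _ => norm_nonneg _) (fun k => ?_)
    (by simpa using Tendsto.const_mul (μ.real B)⁻¹ h)
  rw [avg_sub B (hf k) hf₀]
  have hint : Integrable (fun ω => ‖f k ω - f₀ ω‖) μ := ((hf k).sub hf₀).norm
  exact (norm_avg_le μ B _).trans (mul_le_mul_of_nonneg_left
    (setIntegral_le_integral hint (Eventually.of_forall fun ω => norm_nonneg _)) (by positivity))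

lemma AveragesConverge.averagesRelCompact {μ : Measure Ω} {f : ℕ → Ω → E} {f₀ : Ω → E}
    (h : AveragesConverge μ f f₀) : AveragesRelCompact μ f := fun B hB =>
  (tendsto_iff_norm_sub_tendsto_zero.2 (h B hB)).isCompact_insert_range.closure_of_subset
    (Set.subset_insert _ _)

/-- A sequence with relatively compact range that converges weakly converges in norm. -/
lemma tendsto_of_isCompact_closure_range_of_weak {y : ℕ → E} {y₀ : E}
    (hK : IsCompact (closure (Set.range y)))
    (hw : ∀ x' : StrongDual ℝ E, Tendsto (fun k => x' (y k)) atTop (𝓝 (x' y₀))) :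
    Tendsto y atTop (𝓝 y₀) := by
  refine tendsto_of_subseq_tendsto fun n hn => ?_
  obtain ⟨z, -, m, hm, hz⟩ := hK.tendsto_subseq (x := fun j => y (n j))
    fun j => subset_closure (Set.mem_range_self _)
  have hzy : z = y₀ := by
    rw [SeparatingDual.eq_iff_forall_dual_eq (R := ℝ)]
    intro x'
    exact tendsto_nhds_unique ((x'.continuous.tendsto z).comp hz)
      ((hw x').comp (hn.comp hm.tendsto_atTop))
  exact ⟨m, hzy ▸ hz⟩

lemma ConvergesAgainst.averagesConverge [CompleteSpace E] {μ : Measure Ω}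
    {f : ℕ → Ω → E} {f₀ : Ω → E} (hf : ∀ k, Integrable (f k) μ) (hf₀ : Integrable f₀ μ)
    (h : ConvergesAgainst μ (StrongLinfty μ E) f f₀) (hK : AveragesRelCompact μ f) :
    AveragesConverge μ f f₀ := by
  intro B hB
  rw [← tendsto_iff_norm_sub_tendsto_zero]
  refine tendsto_of_isCompact_closure_range_of_weak (hK B hB) fun x' => ?_
  have hb : (B.indicator fun _ => x') ∈ StrongLinfty μ E :=
    ⟨aestronglyMeasurable_const.indicator hB.1, ‖x'‖, fun ω => norm_indicator_le_norm_self _ _⟩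
  have hint : ∀ g : Ω → E, Integrable g μ →
      x' (avg μ B g) = (μ.real B)⁻¹ * ∫ ω, (B.indicator fun _ => x') ω (g ω) ∂μ := by
    intro g hg
    rw [avg, map_smul, smul_eq_mul, ← x'.integral_comp_comm hg.integrableOn,
      ← integral_indicator hB.1]
    congr 2
    ext ω
    by_cases hω : ω ∈ B <;> simp [hω]
  simp only [hint _ (hf _), hint _ hf₀]
  exact (h _ hb).const_mul _

/-! ### Bocce oscillations -/

/-- The mean of `f` lies within the mean deviation from `c` of `c` itself, hence the factor 2. -/
lemma bocceOsc_le {μ : Measure Ω} [IsFiniteMeasure μ] [CompleteSpace E] {A : Set Ω}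
    (hA : 0 < μ.real A) {f : Ω → E} (hf : Integrable f μ) (c : E) :
    bocceOsc μ A f ≤ 2 * ((∫ ω in A, ‖f ω - c‖ ∂μ) / μ.real A) := by
  have hfc : Integrable (fun ω => f ω - c) μ := hf.sub (integrable_const c)
  have hc : avg μ A (fun _ => c) = c := by
    simp [avg, smul_smul, inv_mul_cancel₀ hA.ne']
  have hm : ‖c - avg μ A f‖ ≤ (∫ ω in A, ‖f ω - c‖ ∂μ) / μ.real A := by
    have := norm_avg_le μ A (fun ω => f ω - c)
    rwa [← avg_sub A hf (integrable_const c), hc, norm_sub_rev, ← div_eq_inv_mul] at this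
  have hle : ∫ ω in A, ‖f ω - avg μ A f‖ ∂μ ≤
      ∫ ω in A, (‖f ω - c‖ + (∫ ω in A, ‖f ω - c‖ ∂μ) / μ.real A) ∂μ := by
    refine integral_mono (hf.sub (integrable_const _)).norm.integrableOn
      (hfc.norm.add (integrable_const _)).integrableOn fun ω => ?_
    calc ‖f ω - avg μ A f‖ = ‖(f ω - c) + (c - avg μ A f)‖ := by rw [sub_add_sub_cancel]
      _ ≤ _ := (norm_add_le _ _).trans (by gcongr)
  rw [integral_add hfc.norm.integrableOn (integrable_const _), setIntegral_const, smul_eq_mul,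
    mul_div_cancel₀ _ hA.ne', ← two_mul] at hle
  rw [bocceOsc, ← mul_div_assoc]
  gcongr

/-- A strongly measurable function is nearly constant on some subset of positive measure. -/
lemma exists_posSubset_forall_norm_sub_le {F : Type*} [NormedAddCommGroup F] {μ : Measure Ω}
    {f : Ω → F}
    (hf : AEStronglyMeasurable f μ) {B : Set Ω} (hB : B ∈ PosSubsets μ Set.univ)
    {δ : ℝ} (hδ : 0 < δ) :
    ∃ A ∈ PosSubsets μ B, ∃ c : F, ∀ᵐ ω ∂μ.restrict A, ‖f ω - c‖ ≤ δ := by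
  have hm := hf.stronglyMeasurable_mk
  -- By separability countably many `δ`-balls cover the range, so one of the preimages meets `B` in
  -- positive measure.
  obtain ⟨s, hs, hsub⟩ := hm.isSeparable_range
  have hmeas : ∀ c, MeasurableSet (B ∩ hf.mk f ⁻¹' Metric.closedBall c δ) := fun c =>
    hB.1.inter (by
      have := (hm.sub (stronglyMeasurable_const (b := c))).norm.measurable
        (measurableSet_Iic (a := δ))
      convert this using 1
      ext ω
      simp [dist_eq_norm])
  have hcover : B ⊆ ⋃ c ∈ s, B ∩ hf.mk f ⁻¹' Metric.closedBall c δ := by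
    intro ω hω
    obtain ⟨c, hc, hd⟩ := Metric.mem_closure_iff.1 (hsub (Set.mem_range_self ω)) δ hδ
    exact Set.mem_biUnion hc ⟨hω, hd.le⟩
  have hex : ∃ c ∈ s, μ (B ∩ hf.mk f ⁻¹' Metric.closedBall c δ) ≠ 0 := by
    by_contra! hcon
    exact hB.2.2.ne' (measure_mono_null hcover ((measure_biUnion_null_iff hs).2 hcon))
  obtain ⟨c, -, hc⟩ := hex
  refine ⟨_, ⟨hmeas c, Set.inter_subset_left, pos_iff_ne_zero.2 hc⟩, c, ?_⟩
  filter_upwards [ae_restrict_of_ae hf.ae_eq_mk, ae_restrict_mem (hmeas c)] with ω h1 h2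
  rw [h1, ← dist_eq_norm]
  exact h2.2

lemma setIntegral_norm_sub_le {F : Type*} [NormedAddCommGroup F] {μ : Measure Ω}
    [IsFiniteMeasure μ] {A : Set Ω} {f : Ω → F} {c : F} {δ : ℝ} (hf : Integrable f μ)
    (h : ∀ᵐ ω ∂μ.restrict A, ‖f ω - c‖ ≤ δ) : ∫ ω in A, ‖f ω - c‖ ∂μ ≤ δ * μ.real A := by
  calc ∫ ω in A, ‖f ω - c‖ ∂μ ≤ ∫ _ in A, δ ∂μ :=
        integral_mono_ae (hf.sub (integrable_const c)).norm.integrableOn (integrable_const δ) h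
    _ = δ * μ.real A := by rw [setIntegral_const, smul_eq_mul, mul_comm]

/-- The set `A` is chosen from `f₀` alone. Two errors `ε / 8` add up to a mean deviation `ε / 4`,
which `bocceOsc_le` doubles to `ε / 2`. -/
lemma ConvergesStrongly.sequentialBocce [CompleteSpace E] {μ : Measure Ω} [IsFiniteMeasure μ]
    {f : ℕ → Ω → E} {f₀ : Ω → E} (hf : ∀ k, Integrable (f k) μ) (hf₀ : Integrable f₀ μ)
    (h : ConvergesStrongly μ f f₀) : SequentialBocce μ f := by
  intro n hn ε hε B hB
  obtain ⟨A, hA, c, hc⟩ := exists_posSubset_forall_norm_sub_le hf₀.aestronglyMeasurable hB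
    (δ := ε / 8) (by positivity)
  have hpos := PosSubsets.measureReal_pos hA
  refine ⟨A, hA, ?_⟩
  have hev : ∀ᶠ j in atTop, bocceOsc μ A (f (n j)) ≤ ε / 2 := by
    have hlt : ∀ᶠ k in atTop, ∫ ω, ‖f k ω - f₀ ω‖ ∂μ < ε / 8 * μ.real A :=
      h.eventually_lt_const (by positivity)
    filter_upwards [hn.tendsto_atTop.eventually hlt] with j hj
    refine (bocceOsc_le hpos (hf (n j)) c).trans ?_
    have hi₁ : Integrable (fun ω => ‖f (n j) ω - f₀ ω‖) μ := ((hf _).sub hf₀).norm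
    have hi₂ : Integrable (fun ω => ‖f₀ ω - c‖) μ := (hf₀.sub (integrable_const c)).norm
    have h1 : ∫ ω in A, ‖f (n j) ω - c‖ ∂μ ≤
        ∫ ω in A, (‖f (n j) ω - f₀ ω‖ + ‖f₀ ω - c‖) ∂μ :=
      integral_mono ((hf _).sub (integrable_const c)).norm.integrableOn (hi₁.add hi₂).integrableOn
        fun ω => norm_sub_le_norm_sub_add_norm_sub _ _ _
    rw [integral_add hi₁.integrableOn hi₂.integrableOn] at h1
    have h2 := setIntegral_norm_sub_le hf₀ hc
    have h3 : ∫ ω in A, ‖f (n j) ω - f₀ ω‖ ∂μ ≤ ∫ ω, ‖f (n j) ω - f₀ ω‖ ∂μ :=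
      setIntegral_le_integral hi₁ (Eventually.of_forall fun ω => norm_nonneg _)
    have h4 : (∫ ω in A, ‖f (n j) ω - c‖ ∂μ) / μ.real A ≤ ε / 4 := by
      rw [div_le_iff₀ hpos]
      linarith
    linarith
  calc liminf (fun j => ((bocceOsc μ A (f (n j)) : ℝ) : EReal)) atTop ≤ ((ε / 2 : ℝ) : EReal) :=
        liminf_le_of_frequently_le (hev.mono fun j hj => EReal.coe_le_coe_iff.2 hj).frequently
    _ < (ε : EReal) := EReal.coe_lt_coe_iff.2 (by linarith)

/-! ### Uniform integrability of weakly convergent sequences -/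

/-- The `L¹` norm of `g` over all sets is almost attained by a simple function with
values in the dual unit ball. -/
lemma exists_simpleFunc_setIntegral_norm_le {μ : Measure Ω} {g : Ω → E} (hg : Integrable g μ)
    {η : ℝ} (hη : 0 < η) :
    ∃ b : SimpleFunc Ω (StrongDual ℝ E), (∀ ω, ‖b ω‖ ≤ 1) ∧
      ∀ A : Set Ω, ∫ ω in A, ‖g ω‖ ∂μ ≤ ∫ ω in A, b ω (g ω) ∂μ + η := by
  obtain ⟨s, hs, hsm⟩ := (memLp_one_iff_integrable.2 hg).exists_simpleFunc_eLpNorm_sub_lt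
    ENNReal.one_ne_top (ε := ENNReal.ofReal (η / 2)) (by simpa using hη)
  have hsi : Integrable s μ := memLp_one_iff_integrable.1 hsm
  have hgs : Integrable (fun ω => ‖g ω - s ω‖) μ := (hg.sub hsi).norm
  have hsmall : ∫ ω, ‖g ω - s ω‖ ∂μ ≤ η / 2 := by
    have h := integral_norm_eq_lintegral_enorm (hg.sub hsi).aestronglyMeasurable
    rw [eLpNorm_one_eq_lintegral_enorm] at hs
    calc ∫ ω, ‖g ω - s ω‖ ∂μ = _ := h
      _ ≤ η / 2 := ENNReal.toReal_le_of_le_ofReal (by positivity) hs.le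
  -- The test function norms `s` pointwise, so on `g` it loses at most `2‖g - s‖`, whatever the set
  -- `A`.
  choose φ hφ₁ hφ₂ using fun x : E => exists_dual_vector'' ℝ x
  refine ⟨s.map φ, fun ω => hφ₁ _, fun A => ?_⟩
  have hb : ⇑(s.map φ) ∈ ScalarLinfty μ E := strongLinfty_subset_scalarLinfty μ
    ⟨(s.map φ).stronglyMeasurable.aestronglyMeasurable, 1, fun ω => hφ₁ _⟩
  have hbg := integrable_dual_apply hb hg
  have hpt : ∀ ω, ‖g ω‖ ≤ (s.map φ) ω (g ω) + 2 * ‖g ω - s ω‖ := by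
    intro ω
    have h1 : ‖g ω‖ ≤ ‖s ω‖ + ‖g ω - s ω‖ := norm_le_norm_add_norm_sub' _ _
    have h2 : φ (s ω) (s ω) = ‖s ω‖ := hφ₂ _
    have h3 : φ (s ω) (s ω - g ω) ≤ ‖g ω - s ω‖ := by
      rw [norm_sub_rev]
      exact (le_abs_self _).trans (by simpa using (φ (s ω)).le_of_opNorm_le (hφ₁ _) (s ω - g ω))
    rw [map_sub] at h3
    rw [SimpleFunc.map_apply]
    linarith
  calc ∫ ω in A, ‖g ω‖ ∂μ ≤ ∫ ω in A, ((s.map φ) ω (g ω) + 2 * ‖g ω - s ω‖) ∂μ :=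
        integral_mono hg.norm.integrableOn (hbg.add (hgs.const_mul 2)).integrableOn hpt
    _ = ∫ ω in A, (s.map φ) ω (g ω) ∂μ + 2 * ∫ ω in A, ‖g ω - s ω‖ ∂μ := by
        rw [integral_add hbg.integrableOn (hgs.const_mul 2).integrableOn, integral_const_mul]
    _ ≤ _ := by
        have := setIntegral_le_integral (s := A) hgs (Eventually.of_forall fun ω => norm_nonneg _)
        linarith

/-- The unit ball of the bounded functions, inside `L¹`. -/
def unitBallL1 (μ : Measure Ω) (F : Type*) [NormedAddCommGroup F] : Set (Lp F 1 μ) :=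
  {b | ∀ᵐ ω ∂μ, ‖b ω‖ ≤ 1}

lemma exists_subseq_tendsto_ae {F : Type*} [NormedAddCommGroup F] {μ : Measure Ω}
    {b : ℕ → Lp F 1 μ} {b₀ : Lp F 1 μ} (h : Tendsto b atTop (𝓝 b₀)) :
    ∃ n : ℕ → ℕ, StrictMono n ∧ ∀ᵐ ω ∂μ, Tendsto (fun i => b (n i) ω) atTop (𝓝 (b₀ ω)) :=
  (tendstoInMeasure_of_tendsto_Lp h).exists_seq_tendsto_ae

lemma isClosed_unitBallL1 (μ : Measure Ω) (F : Type*) [NormedAddCommGroup F] :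
    IsClosed (unitBallL1 μ F) := by
  refine IsSeqClosed.isClosed fun b b₀ hb h => ?_
  obtain ⟨n, -, hn⟩ := exists_subseq_tendsto_ae h
  filter_upwards [hn, ae_all_iff.2 hb] with ω h1 h2
  exact le_of_tendsto h1.norm (Eventually.of_forall fun i => h2 _)

/-- The test class asks for a bound everywhere, the ball only almost everywhere. -/
lemma exists_strongLinfty_ae_eq {μ : Measure Ω} {b : Lp (StrongDual ℝ E) 1 μ}
    (hb : b ∈ unitBallL1 μ (StrongDual ℝ E)) : ∃ b' ∈ StrongLinfty μ E, b' =ᵐ[μ] b := by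
  have hm := Lp.stronglyMeasurable b
  refine ⟨{ω | ‖b ω‖ ≤ 1}.indicator b, ⟨(hm.indicator
    (hm.norm.measurable measurableSet_Iic)).aestronglyMeasurable, 1, fun ω => ?_⟩, ?_⟩
  · by_cases h : ‖b ω‖ ≤ 1
    · rwa [Set.indicator_of_mem (by exact h)]
    · rw [Set.indicator_of_notMem (by exact h)]
      simp
  · filter_upwards [hb] with ω hω
    exact Set.indicator_of_mem (by exact hω) _

lemma integrable_unitBallL1_apply {μ : Measure Ω} {b : Lp (StrongDual ℝ E) 1 μ}
    (hb : b ∈ unitBallL1 μ (StrongDual ℝ E)) {g : Ω → E} (hg : Integrable g μ) :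
    Integrable (fun ω => b ω (g ω)) μ := by
  obtain ⟨b', hb', he⟩ := exists_strongLinfty_ae_eq hb
  refine (integrable_dual_apply (strongLinfty_subset_scalarLinfty μ hb') hg).congr ?_
  filter_upwards [he] with ω hω
  rw [hω]

/-- Since `g` is merely integrable, the pairing need not be Lipschitz in the `L¹` metric; an a.e.
convergent subsequence and domination by `‖g‖` replace this. -/
lemma isClosed_setOf_abs_integral_dual_apply_le {μ : Measure Ω} {g : Ω → E}
    (hg : Integrable g μ) (ε : ℝ) :
    IsClosed {b : unitBallL1 μ (StrongDual ℝ E) |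
      |∫ ω, (b : Lp (StrongDual ℝ E) 1 μ) ω (g ω) ∂μ| ≤ ε} := by
  refine IsSeqClosed.isClosed fun b b₀ hb h => ?_
  obtain ⟨n, -, hn⟩ := exists_subseq_tendsto_ae ((continuous_subtype_val.tendsto _).comp h)
  have hlim : Tendsto (fun i => ∫ ω, (b (n i) : Lp (StrongDual ℝ E) 1 μ) ω (g ω) ∂μ) atTop
      (𝓝 (∫ ω, (b₀ : Lp (StrongDual ℝ E) 1 μ) ω (g ω) ∂μ)) := by
    refine tendsto_integral_of_dominated_convergence (fun ω => ‖g ω‖)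
      (fun i => (integrable_unitBallL1_apply (b (n i)).2 hg).aestronglyMeasurable) hg.norm
      (fun i => ?_) ?_
    · filter_upwards [(b (n i)).2] with ω hω
      simpa using ContinuousLinearMap.le_of_opNorm_le _ hω (g ω)
    · filter_upwards [hn] with ω hω
      exact ((ContinuousLinearMap.apply ℝ ℝ (g ω)).continuous.tendsto _).comp hω
  exact le_of_tendsto hlim.abs (Eventually.of_forall fun i => hb _)

/-- A sequence in `L¹_E` that converges to zero against all bounded strongly measurable functions
is equi-integrable. -/
lemma exists_forall_setIntegral_norm_le {μ : Measure Ω} [IsFiniteMeasure μ] {g : ℕ → Ω → E}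
    (hg : ∀ k, Integrable (g k) μ)
    (h : ∀ b ∈ StrongLinfty μ E, Tendsto (fun k => ∫ ω, b ω (g k ω) ∂μ) atTop (𝓝 0))
    {η : ℝ} (hη : 0 < η) :
    ∃ r > 0, ∀ᶠ k in atTop, ∀ A, MeasurableSet A → μ.real A < r →
      ∫ ω in A, ‖g k ω‖ ∂μ ≤ η := by
  let X := unitBallL1 μ (StrongDual ℝ E)
  have : CompleteSpace X := (isClosed_unitBallL1 μ _).completeSpace_coe
  have : Nonempty X := ⟨0, by
    filter_upwards [Lp.coeFn_zero (StrongDual ℝ E) 1 μ] with ω hω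
    rw [hω]
    simp⟩
  let C : ℕ → Set X := fun n =>
    ⋂ k ≥ n, {b : X | |∫ ω, (b : Lp (StrongDual ℝ E) 1 μ) ω (g k ω) ∂μ| ≤ η / 2}
  have hC : ∀ n, IsClosed (C n) := fun n => isClosed_biInter fun k _ =>
    isClosed_setOf_abs_integral_dual_apply_le (hg k) _
  have hU : ⋃ n, C n = Set.univ := by
    refine Set.eq_univ_of_forall fun b => ?_
    obtain ⟨b', hb', he⟩ := exists_strongLinfty_ae_eq b.2
    obtain ⟨n, hn⟩ := eventually_atTop.1
      ((h b' hb').abs.eventually_le_const (u := η / 2) (by simpa using hη))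
    refine Set.mem_iUnion.2 ⟨n, Set.mem_iInter₂.2 fun k hk => ?_⟩
    have : ∫ ω, (b : Lp (StrongDual ℝ E) 1 μ) ω (g k ω) ∂μ = ∫ ω, b' ω (g k ω) ∂μ := by
      refine integral_congr_ae ?_
      filter_upwards [he] with ω hω
      rw [hω]
    rw [Set.mem_ofPred_eq, this]
    exact hn k hk
  -- Baire: the pairings with all `g k`, `k ≥ n`, are at most `η / 2` on a whole ball around `b₀`.
  obtain ⟨n, b₀, hb₀⟩ := nonempty_interior_of_iUnion_of_closed hC hU
  obtain ⟨r, hr, hball⟩ := Metric.isOpen_iff.1 isOpen_interior b₀ hb₀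
  refine ⟨r / 2, by positivity, eventually_atTop.2 ⟨n, fun k hk A hA hAr => ?_⟩⟩
  obtain ⟨d, hd, hdA⟩ := exists_simpleFunc_setIntegral_norm_le (hg k) (half_pos hη)
  -- Replacing `b₀` by `e` on `A` moves it by at most `2 μ(A) < r`, so it stays in that ball.
  have key : ∀ e : Ω → StrongDual ℝ E, StronglyMeasurable e → (∀ ω, ‖e ω‖ ≤ 1) →
      |∫ ω in A, e ω (g k ω) ∂μ +
        ∫ ω in Aᶜ, (b₀ : Lp (StrongDual ℝ E) 1 μ) ω (g k ω) ∂μ| ≤ η / 2 := by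
    intro e he he1
    classical
    let p : Ω → StrongDual ℝ E := A.piecewise e b₀
    have hp : StronglyMeasurable p := he.piecewise hA (Lp.stronglyMeasurable _)
    have hp1 : ∀ᵐ ω ∂μ, ‖p ω‖ ≤ 1 := by
      filter_upwards [b₀.2] with ω hω
      by_cases hωA : ω ∈ A
      · simpa [p, hωA] using he1 ω
      · simpa [p, hωA] using hω
    have hpi : Integrable p μ :=
      (integrable_const (1 : ℝ)).mono' hp.aestronglyMeasurable hp1
    have hpX : hpi.toL1 p ∈ X := by
      filter_upwards [hp1, hpi.coeFn_toL1] with ω h1 h2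
      rwa [h2]
    have hdist : dist (⟨hpi.toL1 p, hpX⟩ : X) b₀ < r := by
      rw [Subtype.dist_eq, dist_eq_norm, L1.norm_eq_integral_norm]
      have hle : ∀ᵐ ω ∂μ, ‖(hpi.toL1 p - (b₀ : Lp (StrongDual ℝ E) 1 μ)) ω‖ ≤
          A.indicator (fun _ => (2 : ℝ)) ω := by
        filter_upwards [Lp.coeFn_sub (hpi.toL1 p) (b₀ : Lp (StrongDual ℝ E) 1 μ),
          hpi.coeFn_toL1, b₀.2] with ω h1 h2 h3
        rw [h1, Pi.sub_apply, h2]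
        by_cases hωA : ω ∈ A
        · have := norm_sub_le (e ω) ((b₀ : Lp (StrongDual ℝ E) 1 μ) ω)
          simp only [p, hωA, Set.piecewise_eq_of_mem, Set.indicator_of_mem]
          linarith [he1 ω]
        · simp [p, hωA]
      calc _ ≤ ∫ ω, A.indicator (fun _ => (2 : ℝ)) ω ∂μ :=
            integral_mono_ae (L1.integrable_coeFn _).norm
              ((integrable_const (2 : ℝ)).indicator hA) hle
        _ = μ.real A * 2 := by
            rw [integral_indicator hA, setIntegral_const, smul_eq_mul]
        _ < r := by linarith
    have hmem := Set.mem_iInter₂.1 (interior_subset (hball hdist)) k hk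
    have hpg : Integrable (fun ω => p ω (g k ω)) μ :=
      (integrable_unitBallL1_apply hpX (hg k)).congr (by
        filter_upwards [hpi.coeFn_toL1] with ω hω
        rw [hω])
    have heq : ∫ ω, hpi.toL1 p ω (g k ω) ∂μ = ∫ ω in A, e ω (g k ω) ∂μ +
        ∫ ω in Aᶜ, (b₀ : Lp (StrongDual ℝ E) 1 μ) ω (g k ω) ∂μ := by
      calc ∫ ω, hpi.toL1 p ω (g k ω) ∂μ = ∫ ω, p ω (g k ω) ∂μ := by
            refine integral_congr_ae ?_
            filter_upwards [hpi.coeFn_toL1] with ω hω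
            rw [hω]
        _ = _ := by
            rw [← integral_add_compl hA hpg]
            congr 1
            · exact setIntegral_congr_fun hA fun ω hω => by simp [p, hω]
            · exact setIntegral_congr_fun hA.compl fun ω hω => by
                simp [p, Set.piecewise_eq_of_notMem _ _ _ hω]
    rw [← heq]
    exact hmem
  -- Comparing `d` with `-d` cancels the integral over `Aᶜ`.
  have h1 := key d d.stronglyMeasurable hd
  have h2 := key (fun ω => -d ω) d.stronglyMeasurable.neg (by simpa using hd)
  simp only [neg_apply, integral_neg] at h2
  rw [abs_le] at h1 h2
  linarith [hdA A]

/-! ### From small averages on small sets to convergence in `L¹` -/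

/-- An equi-integrable sequence of nonnegative functions, every subsequence of which has
infinitely many small averages on some subset of each set of positive measure, tends to zero
in `L¹`. -/
lemma tendsto_integral_zero_of_frequently_setIntegral_le {μ : Measure Ω} [IsFiniteMeasure μ]
    {g : ℕ → Ω → ℝ} (hg : ∀ k, Integrable (g k) μ) (hg0 : ∀ k ω, 0 ≤ g k ω)
    (hui : ∀ η : ℝ, 0 < η → ∃ r > 0, ∀ᶠ k in atTop, ∀ A, MeasurableSet A → μ.real A < r →
      ∫ ω in A, g k ω ∂μ ≤ η)
    (hsmall : ∀ n : ℕ → ℕ, StrictMono n → ∀ ε : ℝ, 0 < ε → ∀ B ∈ PosSubsets μ Set.univ,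
      ∃ A ∈ PosSubsets μ B, ∃ᶠ j in atTop, ∫ ω in A, g (n j) ω ∂μ ≤ ε * μ.real A) :
    Tendsto (fun k => ∫ ω, g k ω ∂μ) atTop (𝓝 0) := by
  classical
  rw [Metric.tendsto_nhds]
  by_contra! hcon
  obtain ⟨δ, hδ, hfreq⟩ := hcon
  replace hfreq : ∃ᶠ k in atTop, δ ≤ ∫ ω, g k ω ∂μ := by
    refine hfreq.mono fun k hk => ?_
    rwa [Real.dist_eq, sub_zero, abs_of_nonneg (integral_nonneg (hg0 k))] at hk
  set ε : ℝ := δ / (2 * (μ.real Set.univ + 1)) with hεdef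
  have hM : 0 ≤ μ.real Set.univ := measureReal_nonneg
  have hε : 0 < ε := by positivity
  have hεM : ε * μ.real Set.univ < δ / 2 := by
    have : ε * (μ.real Set.univ + 1) = δ / 2 := by
      rw [hεdef]
      field_simp
    nlinarith
  let Q : Set Ω → ℕ → Prop := fun A k => ∫ ω in A, g k ω ∂μ ≤ ε * μ.real A
  -- The joint condition concerns finite subfamilies only, so it survives unions of chains. Allowing
  -- `∅` keeps the family nonempty, hence enumerable by `ℕ`.
  let S : Set (Set (Set Ω)) := {𝒜 | (∀ A ∈ 𝒜, MeasurableSet A ∧ (A = ∅ ∨ 0 < μ A)) ∧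
    𝒜.PairwiseDisjoint id ∧
    ∀ t : Finset (Set Ω), ↑t ⊆ 𝒜 → ∃ᶠ k in atTop, δ ≤ ∫ ω, g k ω ∂μ ∧ ∀ A ∈ t, Q A k}
  have hbase : {∅} ∈ S := by
    refine ⟨by simp, Set.pairwiseDisjoint_singleton _ _, fun t ht => hfreq.mono fun k hk =>
      ⟨hk, fun A hA => ?_⟩⟩
    obtain rfl : A = ∅ := ht hA
    simp [Q]
  obtain ⟨𝒜, hbot, hmax⟩ := zorn_subset_nonempty S (fun c hcS hc hne => by
    refine ⟨⋃₀ c, ⟨?_, ?_, ?_⟩, fun s hs => Set.subset_sUnion_of_mem hs⟩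
    · rintro A ⟨s, hs, hA⟩
      exact (hcS hs).1 A hA
    · exact (Set.pairwiseDisjoint_sUnion hc.directedOn).2 fun s hs => (hcS hs).2.1
    · intro t ht
      obtain ⟨s, hs, hts⟩ := hc.directedOn.exists_mem_subset_of_finite_of_subset_sUnion hne
        t.finite_toSet ht
      exact (hcS hs).2.2 t hts) {∅} hbase
  obtain ⟨h𝒜m, h𝒜d, h𝒜f⟩ := hmax.prop
  have hcount : 𝒜.Countable := by
    have h := Measure.countable_meas_pos_of_disjoint_iUnion (μ := μ)
      (As := fun A : 𝒜 => (A : Set Ω)) (fun A => (h𝒜m A A.2).1)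
      (fun A B hAB => h𝒜d A.2 B.2 (Subtype.coe_ne_coe.2 hAB))
    refine ((h.image Subtype.val).insert ∅).mono fun A hA => ?_
    rcases (h𝒜m A hA).2 with h0 | h0
    · exact Or.inl h0
    · exact Or.inr ⟨⟨A, hA⟩, h0, rfl⟩
  obtain ⟨A, rfl⟩ := hcount.exists_eq_range ⟨∅, hbot rfl⟩
  have hAm : ∀ i, MeasurableSet (A i) := fun i => (h𝒜m _ (Set.mem_range_self i)).1
  have hinit : ∀ N, ∃ᶠ k in atTop, δ ≤ ∫ ω, g k ω ∂μ ∧ ∀ i ≤ N, Q (A i) k := by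
    intro N
    refine (h𝒜f ((Finset.range (N + 1)).image A) ?_).mono fun k hk =>
      ⟨hk.1, fun i hi => hk.2 _ (Finset.mem_image_of_mem _ (Finset.mem_range_succ_iff.2 hi))⟩
    rw [Finset.coe_image]
    exact Set.image_subset_range _ _
  -- Diagonal subsequence: each fixed `A i` is good for `n j` as soon as `j ≥ i`.
  obtain ⟨n, hn, hnQ⟩ := extraction_forall_of_frequently hinit
  -- Otherwise `hsmall`, applied along the diagonal subsequence, finds a new set `A'` that can be
  -- added, against maximality.
  have hnull : μ (⋃ i, A i)ᶜ = 0 := by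
    by_contra hpos
    obtain ⟨A', hA', hfr⟩ := hsmall n hn ε hε (⋃ i, A i)ᶜ
      ⟨(MeasurableSet.iUnion hAm).compl, Set.subset_univ _, pos_iff_ne_zero.2 hpos⟩
    have hdisj : ∀ i, Disjoint A' (A i) := fun i =>
      (Set.disjoint_compl_left_iff_subset.2 (Set.subset_iUnion A i)).mono_left hA'.2.1
    have hins : insert A' (Set.range A) ∈ S := by
      refine ⟨?_, ?_, fun t ht => ?_⟩
      · rintro B (rfl | hB)
        · exact ⟨hA'.1, Or.inr hA'.2.2⟩
        · exact h𝒜m B hB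
      · refine h𝒜d.insert ?_
        rintro _ ⟨i, rfl⟩ _
        exact hdisj i
      · have hev : ∀ B ∈ t, B ≠ A' → ∀ᶠ j in atTop, Q B (n j) := by
          intro B hB hne
          obtain ⟨i, rfl⟩ := (ht hB).resolve_left hne
          exact eventually_atTop.2 ⟨i, fun j hj => (hnQ j).2 i hj⟩
        have hev' : ∀ᶠ j in atTop, ∀ B ∈ t, B ≠ A' → Q B (n j) :=
          (eventually_all_finset t).2 fun B hB => by
            by_cases hne : B = A'
            · simp [hne]
            · simpa [hne] using hev B hB hne
        refine hn.tendsto_atTop.frequently ((hfr.and_eventually hev').mono fun j hj =>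
          ⟨(hnQ j).1, fun B hB => ?_⟩)
        by_cases hne : B = A'
        · rw [hne]
          exact hj.1
        · exact hj.2 B hB hne
    obtain ⟨i, hi⟩ := hmax.le_of_ge hins (Set.subset_insert _ _) (Set.mem_insert A' _)
    have := hdisj i
    rw [hi, disjoint_self] at this
    exact hA'.2.2.ne' (by rw [this]; exact measure_empty)
  -- The enumeration may repeat sets; taking the image as a `Finset` removes repetitions, so
  -- integrals over `U N` split into sums.
  let U : ℕ → Set Ω := fun N => ⋃ B ∈ (Finset.range (N + 1)).image A, B
  have hUm : ∀ N, MeasurableSet (U N) := fun N => Finset.measurableSet_biUnion _ fun B hB => by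
    obtain ⟨i, -, rfl⟩ := Finset.mem_image.1 hB
    exact hAm i
  have hUmono : Monotone U := fun N M hNM => Set.biUnion_subset_biUnion_left fun B hB =>
    Finset.image_subset_image (Finset.range_subset_range.2 (by omega)) hB
  have hUlim : Tendsto (fun N => μ.real (U N)ᶜ) atTop (𝓝 0) := by
    have h := tendsto_measure_iInter_atTop (μ := μ) (s := fun N => (U N)ᶜ)
      (fun N => (hUm N).compl.nullMeasurableSet)
      (fun N M hNM => Set.compl_subset_compl.2 (hUmono hNM)) ⟨0, measure_ne_top _ _⟩
    have h0 : μ (⋂ N, (U N)ᶜ) = 0 := by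
      refine measure_mono_null ?_ hnull
      rw [← Set.compl_iUnion, Set.compl_subset_compl]
      exact Set.iUnion_mono fun i => Set.subset_biUnion_of_mem (u := fun B : Set Ω => B)
        (Finset.mem_image_of_mem A (Finset.self_mem_range_succ i))
    rw [h0] at h
    exact (ENNReal.tendsto_toReal ENNReal.zero_ne_top).comp h
  -- The remainder contributes at most `δ / 4` and the good sets less than `δ / 2`, in total less
  -- than `δ`.
  obtain ⟨r, hr, hrk⟩ := hui (δ / 4) (by positivity)
  obtain ⟨N, hN⟩ := (hUlim.eventually_lt_const hr).exists
  obtain ⟨k, ⟨hk, hkQ⟩, hkr⟩ := ((hinit N).and_eventually hrk).exists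
  have hrest := hkr _ (hUm N).compl hN
  have hmain : ∫ ω in U N, g k ω ∂μ ≤ ε * μ.real Set.univ := by
    have htm : ∀ B ∈ (Finset.range (N + 1)).image A, MeasurableSet B := fun B hB => by
      obtain ⟨i, -, rfl⟩ := Finset.mem_image.1 hB
      exact hAm i
    have htd : Set.PairwiseDisjoint (↑((Finset.range (N + 1)).image A)) (id : Set Ω → Set Ω) :=
      h𝒜d.subset (by rw [Finset.coe_image]; exact Set.image_subset_range _ _)
    calc ∫ ω in U N, g k ω ∂μ
        = ∑ B ∈ (Finset.range (N + 1)).image A, ∫ ω in B, g k ω ∂μ :=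
          integral_biUnion_finset _ htm htd fun B _ => (hg k).integrableOn
      _ ≤ ∑ B ∈ (Finset.range (N + 1)).image A, ε * μ.real B :=
          Finset.sum_le_sum fun B hB => by
            obtain ⟨i, hi, rfl⟩ := Finset.mem_image.1 hB
            exact hkQ i (Finset.mem_range_succ_iff.1 hi)
      _ = ε * μ.real (U N) := by
          rw [← Finset.mul_sum]
          congr 1
          exact (measureReal_biUnion_finset htd htm).symm
      _ ≤ ε * μ.real Set.univ := by
          gcongr
          · exact measure_ne_top _ _
          · exact Set.subset_univ _
  have hsum := integral_add_compl (hUm N) (hg k)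
  linarith

/-! ### The Bocce criterion and strong convergence -/

lemma SequentialBocce.exists_frequently_setIntegral_norm_sub_le [CompleteSpace E]
    {μ : Measure Ω} [IsFiniteMeasure μ] {f : ℕ → Ω → E} {f₀ : Ω → E}
    (hf : ∀ k, Integrable (f k) μ) (hf₀ : Integrable f₀ μ) (h : SequentialBocce μ f)
    (havg : AveragesConverge μ f f₀) {n : ℕ → ℕ} (hn : StrictMono n) {ε : ℝ} (hε : 0 < ε)
    {B : Set Ω} (hB : B ∈ PosSubsets μ Set.univ) :
    ∃ A ∈ PosSubsets μ B,
      ∃ᶠ j in atTop, ∫ ω in A, ‖f (n j) ω - f₀ ω‖ ∂μ ≤ ε * μ.real A := by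
  -- Shrinking to `B'` before using the Bocce criterion keeps the oscillation of `f₀` small on
  -- whichever `A ⊆ B'` the criterion returns.
  obtain ⟨B', hB', c, hc⟩ := exists_posSubset_forall_norm_sub_le hf₀.aestronglyMeasurable hB
    (δ := ε / 8) (by positivity)
  obtain ⟨A, hA, hlim⟩ := h n hn (ε / 4) (by positivity) B' ⟨hB'.1, Set.subset_univ _, hB'.2.2⟩
  have hpos := PosSubsets.measureReal_pos hA
  refine ⟨A, ⟨hA.1, hA.2.1.trans hB'.2.1, hA.2.2⟩, ?_⟩
  have hclose : ∀ᶠ j in atTop, ‖avg μ A (f (n j)) - avg μ A f₀‖ < ε / 4 :=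
    hn.tendsto_atTop.eventually
      ((havg A ⟨hA.1, Set.subset_univ _, hA.2.2⟩).eventually_lt_const (by positivity))
  have hosc₀ : ∫ ω in A, ‖f₀ ω - avg μ A f₀‖ ∂μ ≤ ε / 4 * μ.real A := by
    rw [← div_le_iff₀ hpos]
    refine (bocceOsc_le hpos hf₀ c).trans ?_
    have h4 : (∫ ω in A, ‖f₀ ω - c‖ ∂μ) / μ.real A ≤ ε / 8 := by
      rw [div_le_iff₀ hpos]
      exact setIntegral_norm_sub_le hf₀ (ae_restrict_of_ae_restrict_of_subset hA.2.1 hc)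
    linarith
  -- The lower limit gives only infinitely many `j`; the averages are close for all large `j`, so
  -- both hold infinitely often.
  refine ((frequently_lt_of_liminf_lt (by isBoundedDefault) hlim).and_eventually hclose).mono ?_
  rintro j ⟨hj, hj'⟩
  have hosc : ∫ ω in A, ‖f (n j) ω - avg μ A (f (n j))‖ ∂μ ≤ ε / 4 * μ.real A := by
    rw [← div_le_iff₀ hpos]
    exact (EReal.coe_lt_coe_iff.1 hj).le
  have hi₁ : Integrable (fun ω => ‖f (n j) ω - avg μ A (f (n j))‖) μ :=
    ((hf _).sub (integrable_const _)).norm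
  have hi₂ : Integrable (fun ω => ‖f₀ ω - avg μ A f₀‖) μ :=
    (hf₀.sub (integrable_const _)).norm
  have hi₁₂ : Integrable (fun ω => ‖f (n j) ω - avg μ A (f (n j))‖ + ‖f₀ ω - avg μ A f₀‖) μ :=
    hi₁.add hi₂
  have hi₃ : Integrable (fun _ : Ω => ε / 4) μ := integrable_const _
  calc ∫ ω in A, ‖f (n j) ω - f₀ ω‖ ∂μ
      ≤ ∫ ω in A, (‖f (n j) ω - avg μ A (f (n j))‖ + ‖f₀ ω - avg μ A f₀‖ + ε / 4) ∂μ := by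
        refine integral_mono ((hf _).sub hf₀).norm.integrableOn
          (hi₁₂.add hi₃).integrableOn fun ω => ?_
        have h1 := norm_sub_le_norm_sub_add_norm_sub (f (n j) ω) (avg μ A (f (n j))) (f₀ ω)
        have h2 := norm_sub_le_norm_sub_add_norm_sub (avg μ A (f (n j))) (avg μ A f₀) (f₀ ω)
        rw [norm_sub_rev (avg μ A f₀)] at h2
        linarith
    _ = ∫ ω in A, ‖f (n j) ω - avg μ A (f (n j))‖ ∂μ + ∫ ω in A, ‖f₀ ω - avg μ A f₀‖ ∂μ +
          ε / 4 * μ.real A := by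
        rw [integral_add hi₁₂.integrableOn hi₃.integrableOn,
          integral_add hi₁.integrableOn hi₂.integrableOn, setIntegral_const, smul_eq_mul,
          mul_comm (μ.real A)]
    _ ≤ ε * μ.real A := by linarith [mul_pos hε hpos]

lemma SequentialBocce.convergesStrongly [CompleteSpace E] {μ : Measure Ω} [IsFiniteMeasure μ]
    {f : ℕ → Ω → E} {f₀ : Ω → E} (hf : ∀ k, Integrable (f k) μ) (hf₀ : Integrable f₀ μ)
    (h : SequentialBocce μ f) (hw : ConvergesAgainst μ (StrongLinfty μ E) f f₀)
    (havg : AveragesConverge μ f f₀) : ConvergesStrongly μ f f₀ := by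
  have hg : ∀ k, Integrable (fun ω => f k ω - f₀ ω) μ := fun k => (hf k).sub hf₀
  refine tendsto_integral_zero_of_frequently_setIntegral_le (fun k => (hg k).norm)
    (fun _ _ => norm_nonneg _) (fun η hη => exists_forall_setIntegral_norm_le hg ?_ hη)
    fun n hn ε hε B hB => h.exists_frequently_setIntegral_norm_sub_le hf hf₀ havg hn hε hB
  intro b hb
  simp only [integral_dual_apply_sub (strongLinfty_subset_scalarLinfty μ hb) (hf _) hf₀]
  exact tendsto_sub_nhds_zero_iff.2 (hw b hb)

end BocceL1

theorem theorem2p3 {Ω E : Type*} [MeasurableSpace Ω] [NormedAddCommGroup E] [NormedSpace ℝ E]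
    [CompleteSpace E] (μ : Measure Ω) [IsFiniteMeasure μ]
    (f : ℕ → Ω → E) (f₀ : Ω → E)
    (hf : ∀ k, Integrable (f k) μ) (hf₀ : Integrable f₀ μ) :
    -- weak convergence, Bocce criterion, relatively compact averages
    (BocceL1.ConvergesStrongly μ f f₀ ↔
      BocceL1.ConvergesAgainst μ (BocceL1.ScalarLinfty μ E) f f₀ ∧
      BocceL1.SequentialBocce μ f ∧ BocceL1.AveragesRelCompact μ f) ∧
    -- weak convergence, Bocce criterion, convergent averages
    (BocceL1.ConvergesStrongly μ f f₀ ↔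
      BocceL1.ConvergesAgainst μ (BocceL1.ScalarLinfty μ E) f f₀ ∧
      BocceL1.SequentialBocce μ f ∧ BocceL1.AveragesConverge μ f f₀) ∧
    -- convergence against strongly measurable test functions, relatively compact averages
    (BocceL1.ConvergesStrongly μ f f₀ ↔
      BocceL1.ConvergesAgainst μ (BocceL1.StrongLinfty μ E) f f₀ ∧
      BocceL1.SequentialBocce μ f ∧ BocceL1.AveragesRelCompact μ f) ∧
    -- convergence against strongly measurable test functions, convergent averages
    (BocceL1.ConvergesStrongly μ f f₀ ↔
      BocceL1.ConvergesAgainst μ (BocceL1.StrongLinfty μ E) f f₀ ∧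
      BocceL1.SequentialBocce μ f ∧ BocceL1.AveragesConverge μ f f₀) ∧
    -- the same with weak convergence tested on all of the norm dual of `L¹_E`
    (BocceL1.ConvergesStrongly μ f f₀ ↔
      BocceL1.ConvergesDualWeakly μ hf hf₀ ∧
      BocceL1.SequentialBocce μ f ∧ BocceL1.AveragesRelCompact μ f) ∧
    (BocceL1.ConvergesStrongly μ f f₀ ↔
      BocceL1.ConvergesDualWeakly μ hf hf₀ ∧
      BocceL1.SequentialBocce μ f ∧ BocceL1.AveragesConverge μ f f₀) := by
  have hS : BocceL1.ConvergesStrongly μ f f₀ →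
      BocceL1.ConvergesAgainst μ (BocceL1.ScalarLinfty μ E) f f₀ :=
    fun h => h.convergesAgainst hf hf₀
  have hmono : BocceL1.ConvergesAgainst μ (BocceL1.ScalarLinfty μ E) f f₀ →
      BocceL1.ConvergesAgainst μ (BocceL1.StrongLinfty μ E) f f₀ :=
    BocceL1.ConvergesAgainst.mono (BocceL1.strongLinfty_subset_scalarLinfty μ)
  have hD : BocceL1.ConvergesStrongly μ f f₀ → BocceL1.ConvergesDualWeakly μ hf hf₀ :=
    fun h => h.convergesDualWeakly hf hf₀
  have hDmono : BocceL1.ConvergesDualWeakly μ hf hf₀ →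
      BocceL1.ConvergesAgainst μ (BocceL1.StrongLinfty μ E) f f₀ :=
    fun h => hmono h.convergesAgainst
  have hB : BocceL1.ConvergesStrongly μ f f₀ → BocceL1.SequentialBocce μ f :=
    fun h => h.sequentialBocce hf hf₀
  have hA : BocceL1.ConvergesStrongly μ f f₀ → BocceL1.AveragesConverge μ f f₀ :=
    fun h => h.averagesConverge hf hf₀
  have hK : BocceL1.ConvergesStrongly μ f f₀ → BocceL1.AveragesRelCompact μ f :=
    fun h => (hA h).averagesRelCompact
  -- The smallest test class suffices here, so this settles the converse in all six equivalences.
  have convA : BocceL1.ConvergesAgainst μ (BocceL1.StrongLinfty μ E) f f₀ →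
      BocceL1.SequentialBocce μ f → BocceL1.AveragesConverge μ f f₀ →
      BocceL1.ConvergesStrongly μ f f₀ :=
    fun hw hb ha => hb.convergesStrongly hf hf₀ hw ha
  have convK : BocceL1.ConvergesAgainst μ (BocceL1.StrongLinfty μ E) f f₀ →
      BocceL1.SequentialBocce μ f → BocceL1.AveragesRelCompact μ f →
      BocceL1.ConvergesStrongly μ f f₀ :=
    fun hw hb hk => convA hw hb (hw.averagesConverge hf hf₀ hk)
  exact ⟨⟨fun h => ⟨hS h, hB h, hK h⟩, fun h => convK (hmono h.1) h.2.1 h.2.2⟩,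
    ⟨fun h => ⟨hS h, hB h, hA h⟩, fun h => convA (hmono h.1) h.2.1 h.2.2⟩,
    ⟨fun h => ⟨hmono (hS h), hB h, hK h⟩, fun h => convK h.1 h.2.1 h.2.2⟩,
    ⟨fun h => ⟨hmono (hS h), hB h, hA h⟩, fun h => convA h.1 h.2.1 h.2.2⟩,
    ⟨fun h => ⟨hD h, hB h, hK h⟩, fun h => convK (hDmono h.1) h.2.1 h.2.2⟩,
    ⟨fun h => ⟨hD h, hB h, hA h⟩, fun h => convA (hDmono h.1) h.2.1 h.2.2⟩⟩
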